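/- Let $d\in\mathbb{N}$ and let $W:\mathbb{R}^d\to(0,\infty)$ be a differentiable function such that $\nu=W^{-d}\,dy$ is a probability measure on $\mathbb{R}^d$. Suppose there are $p>1$ and $\beta>1$ such that $$\liminf_{|y|\to\infty}\frac{W(y)}{|y|^p}>0\qquad\text{and}\qquad \liminf_{|y|\to\infty}\frac{y\cdot\nabla W(y)}{W(y)}\ge\beta ,$$ where the lower limits are taken in $[-\infty,+\infty]$. If $d(\max(p,\beta)-1)\le 1$, suppose in addition that $\int|y|\,d\nu(y)<\infty$. Then for every $\ell$ with $0<\ell<d(p-1)$ there are constants $r_0>0$ and $C>0$ such that $\nu$ satisfies a concentration inequality with parameters $(\varphi,r_0)$ for a function $\varphi$ with $\varphi(r)=Cr^{-\ell}$ for all $r\ge r_0$. That is, $\varphi:[0,\infty)\to[0,1]$ is (strictly) decreasing, every $1$-Lipschitz function $f:\mathbb{R}^d\to\mathbb{R}$ is $\nu$-integrable, and $$\nu\Big(\Big\{f\ge\int f\,d\nu+r\Big\}\Big)\le Cr^{-\ell}\qquad\text{for all } r\ge r_0 .$$ In particular $r_0$ and $C$ do not depend on $f$. -/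

import Mathlib

open MeasureTheory Filter Set Bornology

/-- The measure on `ℝ^d` with Lebesgue density `W^{-d}`. -/
noncomputable def negPowMeasure (d : ℕ) (W : EuclideanSpace ℝ (Fin d) → ℝ) :
    Measure (EuclideanSpace ℝ (Fin d)) :=
  volume.withDensity fun y => ENNReal.ofReal (W y ^ (-(d : ℤ)))

/-- The measure `ν` satisfies a concentration inequality with parameters `(φ, r₀)`, where `r₀ ≥ 0`
and `φ` is a decreasing function from `[0, ∞)` to `[0, 1]` (its values at negative numbers are
irrelevant): every `1`-Lipschitz function `f` is `ν`-integrable (so that its mean is meaningful)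
and `ν {f ≥ ∫ f dν + r} ≤ φ r` for all `r ≥ r₀`. -/
structure SatisfiesConcentration {E : Type*} [PseudoMetricSpace E] [MeasurableSpace E]
    (ν : Measure E) (φ : ℝ → ℝ) (r₀ : ℝ) : Prop where
  nonneg : 0 ≤ r₀
  mapsTo : MapsTo φ (Ici 0) (Icc 0 1)
  decreasing : StrictAntiOn φ (Ici 0)
  integrable : ∀ f : E → ℝ, LipschitzWith 1 f → Integrable f ν
  measure_le : ∀ f : E → ℝ, LipschitzWith 1 f → ∀ r : ℝ, r₀ ≤ r →
    ν.real {x | (∫ z, f z ∂ν) + r ≤ f x} ≤ φ r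

/-! A `1`-Lipschitz `f` satisfies `|f y - f 0| ≤ ‖y‖`, so its mean is at least `f 0 - M`, where `M`
is the first moment, and `f ≥ mean + r` forces `‖y‖ ≥ r - M ≥ r / 2` for large `r`. Markov's
inequality for `‖y‖ ^ l` then gives the rate, uniformly in `f`. The `l`-th moment is finite because
`W ^ (-d)` decays like `‖y‖ ^ (-p * d)` and `l - p * d < -d`. The first moment is either assumed or
comes from growth of order `p` or of any order `q < β`, the latter by integrating the gradient bound
along rays. -/

/-- A function with radial logarithmic derivative at least `q / ‖y‖` outside a ball grows at least
like `‖y‖ ^ q`. -/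
lemma exists_rpow_norm_le_of_le_inner_gradient {E : Type*} [NormedAddCommGroup E]
    [InnerProductSpace ℝ E] [FiniteDimensional ℝ E] {W : E → ℝ}
    (hWpos : ∀ y, 0 < W y) (hWdiff : Differentiable ℝ W) {q R : ℝ} (hR : 0 < R)
    (h : ∀ y, R ≤ ‖y‖ → q * W y ≤ inner ℝ y (gradient W y)) :
    ∃ c > 0, ∀ y, R ≤ ‖y‖ → c * ‖y‖ ^ q ≤ W y := by
  obtain ⟨z, -, hz⟩ := (isCompact_closedBall (0 : E) R).exists_isMinOn
    ⟨0, Metric.mem_closedBall_self hR.le⟩ hWdiff.continuous.continuousOn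
  refine ⟨W z * R ^ (-q), by have := hWpos z; positivity, fun y hy => ?_⟩
  have hy0 : 0 < ‖y‖ := hR.trans_le hy
  set a : ℝ := R / ‖y‖ with ha
  have ha0 : 0 < a := by positivity
  have ha1 : a ≤ 1 := (div_le_one hy0).2 hy
  have hderiv : ∀ t : ℝ, 0 < t → HasDerivAt (fun t : ℝ => W (t • y) * t ^ (-q))
      (inner ℝ (gradient W (t • y)) y * t ^ (-q) + W (t • y) * (-q * t ^ (-q - 1))) t := by
    intro t ht
    have h1 : HasDerivAt (fun t : ℝ => t • y) y t := by
      simpa using (hasDerivAt_id t).smul_const y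
    have h2 := (hWdiff (t • y)).hasGradientAt.hasFDerivAt.comp_hasDerivAt t h1
    exact h2.mul (Real.hasDerivAt_rpow_const (Or.inl ht.ne'))
  -- The derivative is `t ^ (-q - 1) * (⟪t • y, ∇W (t • y)⟫ - q * W (t • y))`, and `‖t • y‖ ≥ R` for
  -- `t ≥ a`.
  have hmono : MonotoneOn (fun t : ℝ => W (t • y) * t ^ (-q)) (Icc a 1) := by
    refine monotoneOn_of_hasDerivWithinAt_nonneg (convex_Icc a 1)
      (fun t ht => (hderiv t (ha0.trans_le ht.1)).continuousAt.continuousWithinAt)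
      (fun t ht => (hderiv t ?_).hasDerivWithinAt) (fun t ht => ?_)
    · rw [interior_Icc] at ht
      exact ha0.trans ht.1
    · rw [interior_Icc] at ht
      have ht0 : 0 < t := ha0.trans ht.1
      have hn : R ≤ ‖t • y‖ := by
        rw [norm_smul, Real.norm_of_nonneg ht0.le]
        exact (div_le_iff₀ hy0).1 ht.1.le
      have h3 := h _ hn
      rw [real_inner_smul_left, real_inner_comm] at h3
      have h4 : t ^ (-q) = t ^ (-q - 1) * t := by
        rw [← Real.rpow_add_one ht0.ne']
        ring_nf
      rw [h4]
      have h5 : 0 < t ^ (-q - 1) := Real.rpow_pos_of_pos ht0 _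
      nlinarith
  have h1 := hmono ⟨le_rfl, ha1⟩ ⟨ha1, le_rfl⟩ ha1
  simp only [one_smul, Real.one_rpow, mul_one] at h1
  have h2 : W z ≤ W (a • y) := hz (by
    rw [mem_closedBall_zero_iff, norm_smul, Real.norm_of_nonneg ha0.le, ha,
      div_mul_cancel₀ _ hy0.ne'])
  have h3 : R ^ (-q) * ‖y‖ ^ q = a ^ (-q) := by
    rw [ha, Real.div_rpow hR.le hy0.le, Real.rpow_neg hy0.le, div_inv_eq_mul]
  calc W z * R ^ (-q) * ‖y‖ ^ q = W z * a ^ (-q) := by rw [mul_assoc, h3]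
    _ ≤ W (a • y) * a ^ (-q) := by gcongr
    _ ≤ W y := h1

/-- If `W` grows at least like `‖y‖ ^ q`, then `W ^ (-d)` has finite moments of every order
`s < d * (q - 1)`. -/
lemma integrable_rpow_norm_negPowMeasure {d : ℕ} {W : EuclideanSpace ℝ (Fin d) → ℝ}
    (hWpos : ∀ y, 0 < W y) (hW : Continuous W) [IsFiniteMeasure (negPowMeasure d W)]
    {q c R s : ℝ} (hc : 0 < c) (hR : 1 ≤ R) (h : ∀ y, R ≤ ‖y‖ → c * ‖y‖ ^ q ≤ W y)
    (hs0 : 0 ≤ s) (hs : s < d * (q - 1)) :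
    Integrable (fun y => ‖y‖ ^ s) (negPowMeasure d W) := by
  have hmeas : Measurable fun y : EuclideanSpace ℝ (Fin d) => ‖y‖ ^ s := by fun_prop
  have hdens : Measurable fun y => W y ^ (-(d : ℤ)) :=
    (hW.zpow₀ _ fun y => Or.inl (hWpos y).ne').measurable
  have hball : MeasurableSet (Metric.closedBall (0 : EuclideanSpace ℝ (Fin d)) R) :=
    Metric.isClosed_closedBall.measurableSet
  rw [← integrableOn_univ, ← union_compl_self (Metric.closedBall 0 R)]
  refine IntegrableOn.union ?_ ?_
  · refine Measure.integrableOn_of_bounded (M := R ^ s) (measure_ne_top _ _)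
      hmeas.aestronglyMeasurable ?_
    filter_upwards [ae_restrict_mem hball] with y hy
    rw [Real.norm_of_nonneg (by positivity)]
    exact Real.rpow_le_rpow (norm_nonneg _) (mem_closedBall_zero_iff.1 hy) hs0
  · rw [IntegrableOn, negPowMeasure, restrict_withDensity hball.compl,
      integrable_withDensity_iff hdens.ennreal_ofReal (by simp)]
    -- The condition `q * d - s > d` is exactly `hs`.
    have hint : Integrable (fun y : EuclideanSpace ℝ (Fin d) => (1 + ‖y‖) ^ (-(q * d - s))) := by
      refine integrable_one_add_norm ?_
      rw [finrank_euclideanSpace_fin]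
      linarith
    refine Integrable.mono' ((hint.const_mul (c ^ (-(d : ℝ)) * 2 ^ (q * d - s))).integrableOn)
      (by fun_prop) ?_
    filter_upwards [ae_restrict_mem hball.compl] with y hy
    have hRy : R < ‖y‖ := by simpa using hy
    have hy0 : 0 < ‖y‖ := by linarith
    have hqd : 0 ≤ q * d - s := by
      have : (0 : ℝ) ≤ d := d.cast_nonneg
      linarith
    have hWy : (0 : ℝ) ≤ W y ^ (-(d : ℤ)) := zpow_nonneg (hWpos y).le _
    rw [ENNReal.toReal_ofReal hWy, Real.norm_of_nonneg (by positivity)]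
    have hdn : W y ^ (-(d : ℤ)) = W y ^ (-(d : ℝ)) := by
      rw [← Real.rpow_intCast]
      norm_num
    have hp : 0 < c * ‖y‖ ^ q := by positivity
    calc ‖y‖ ^ s * W y ^ (-(d : ℤ)) ≤ ‖y‖ ^ s * (c * ‖y‖ ^ q) ^ (-(d : ℝ)) := by
          rw [hdn]
          exact mul_le_mul_of_nonneg_left (Real.rpow_le_rpow_of_nonpos hp (h y hRy.le)
            (neg_nonpos.2 d.cast_nonneg)) (by positivity)
      _ = c ^ (-(d : ℝ)) * ‖y‖ ^ (-(q * d - s)) := by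
          rw [Real.mul_rpow hc.le (by positivity), ← Real.rpow_mul hy0.le, mul_left_comm,
            ← Real.rpow_add hy0]
          ring_nf
      -- Uses `1 ≤ R < ‖y‖`.
      _ ≤ c ^ (-(d : ℝ)) * ((1 + ‖y‖) / 2) ^ (-(q * d - s)) := by
          exact mul_le_mul_of_nonneg_left (Real.rpow_le_rpow_of_nonpos (by positivity)
            (by linarith) (neg_nonpos.2 hqd)) (by positivity)
      _ = c ^ (-(d : ℝ)) * 2 ^ (q * d - s) * (1 + ‖y‖) ^ (-(q * d - s)) := by
          rw [Real.div_rpow (by positivity) (by positivity), Real.rpow_neg zero_le_two,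
            div_inv_eq_mul]
          ring

/-- A probability measure with finite moments of orders `1` and `l` satisfies a concentration
inequality with a rate of order `r ^ (-l)`. -/
lemma exists_satisfiesConcentration_of_integrable {E : Type*} [NormedAddCommGroup E]
    [MeasurableSpace E] [BorelSpace E] [SecondCountableTopology E]
    {ν : Measure E} [IsProbabilityMeasure ν] {l : ℝ} (hl : 0 < l)
    (h1 : Integrable (fun y => ‖y‖) ν) (hmom : Integrable (fun y => ‖y‖ ^ l) ν) :
    ∃ r₀ > 0, ∃ C > 0, ∃ φ : ℝ → ℝ, (∀ r ≥ r₀, φ r = C * r ^ (-l)) ∧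
      SatisfiesConcentration ν φ r₀ := by
  set M := ∫ y, ‖y‖ ∂ν
  set K := ∫ y, ‖y‖ ^ l ∂ν
  have hM : 0 ≤ M := integral_nonneg fun y => norm_nonneg y
  have hK : 0 ≤ K := integral_nonneg fun y => by positivity
  -- The `+ 1` keeps `C` positive, hence `φ` strictly decreasing, even if `K = 0`.
  set C := K * 2 ^ l + 1
  have hC : 0 < C := by positivity
  obtain ⟨r₀, hr₀C, hr₀⟩ : ∃ r₀ : ℝ, C * r₀ ^ (-l) < 1 / 2 ∧ 2 * M + 1 ≤ r₀ := by
    have ht : Tendsto (fun r : ℝ => C * r ^ (-l)) atTop (nhds 0) := by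
      simpa using (tendsto_rpow_neg_atTop hl).const_mul C
    exact ((ht.eventually_lt_const (by norm_num)).and (eventually_ge_atTop _)).exists
  have hr₀pos : 0 < r₀ := by linarith
  have hpow : ∀ {r s : ℝ}, r₀ ≤ r → r < s → C * s ^ (-l) < C * r ^ (-l) := fun hr hrs =>
    mul_lt_mul_of_pos_left
      (Real.rpow_lt_rpow_of_neg (hr₀pos.trans_le hr) hrs (neg_lt_zero.2 hl)) hC
  have hhalf : ∀ {r : ℝ}, r₀ ≤ r → C * r ^ (-l) < 1 / 2 := fun {r} hr => by
    rcases hr.eq_or_lt with rfl | hr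
    · exact hr₀C
    · exact (hpow le_rfl hr).trans hr₀C
  have hlin : ∀ {r : ℝ}, r < r₀ → 1 / 2 < 1 - r / (2 * r₀) := fun {r} hr => by
    have : r / (2 * r₀) < 1 / 2 := by rw [div_lt_iff₀ (by positivity)]; linarith
    linarith
  have hf : ∀ f : E → ℝ, LipschitzWith 1 f → ∀ y, |f y - f 0| ≤ ‖y‖ := fun f hf y => by
    simpa [Real.dist_eq] using hf.dist_le_mul y 0
  have hfint : ∀ f : E → ℝ, LipschitzWith 1 f → Integrable f ν := fun f hLip => by
    refine (h1.add (integrable_const |f 0|)).mono' hLip.continuous.aestronglyMeasurable ?_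
    refine Eventually.of_forall fun y => ?_
    have := abs_add_le (f y - f 0) (f 0)
    rw [sub_add_cancel] at this
    simpa using this.trans (add_le_add_left (hf f hLip y) _)
  -- Below `r₀`, `φ` falls linearly from `1` towards `1 / 2`; the power tail starts under `1 / 2`.
  refine ⟨r₀, hr₀pos, C, hC, fun r => if r₀ ≤ r then C * r ^ (-l) else 1 - r / (2 * r₀),
    fun r hr => if_pos hr, hr₀pos.le, ?_, ?_, hfint, ?_⟩
  · intro r hr
    have hr : 0 ≤ r := hr
    dsimp only
    split_ifs with h
    · exact ⟨by positivity, by linarith [hhalf h]⟩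
    · refine ⟨by linarith [hlin (not_le.1 h)], ?_⟩
      have : 0 ≤ r / (2 * r₀) := by positivity
      linarith
  · intro r hr s hs hrs
    dsimp only
    split_ifs with h h' h'
    · exact hpow h' hrs
    · exact (hhalf h).trans (hlin (not_le.1 h'))
    · exact absurd (h'.trans hrs.le) h
    · gcongr
  · intro f hLip r hr
    have hmean : f 0 - M ≤ ∫ z, f z ∂ν := by
      have := integral_mono ((integrable_const (f 0)).sub h1) (hfint f hLip)
        fun y => by
          have := (abs_le.1 (hf f hLip y)).1
          simp only [Pi.sub_apply]
          linarith
      rw [integral_sub' (integrable_const _) h1] at this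
      simpa using this
    have hr0 : 0 < r := hr₀pos.trans_le hr
    have hsub : {x | (∫ z, f z ∂ν) + r ≤ f x} ⊆ {x | (r / 2) ^ l ≤ ‖x‖ ^ l} := fun x hx => by
      have hx : (∫ z, f z ∂ν) + r ≤ f x := hx
      have := (abs_le.1 (hf f hLip x)).2
      exact Real.rpow_le_rpow (by positivity) (by linarith) hl.le
    have hmarkov := mul_meas_ge_le_integral_of_nonneg
      (Eventually.of_forall fun y : E => by positivity) hmom ((r / 2) ^ l)
    have hr2 : 0 < (r / 2) ^ l := by positivity
    rw [if_pos hr]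
    calc ν.real {x | (∫ z, f z ∂ν) + r ≤ f x} ≤ ν.real {x | (r / 2) ^ l ≤ ‖x‖ ^ l} :=
          measureReal_mono hsub
      _ ≤ K / (r / 2) ^ l := by
          rw [le_div_iff₀ hr2, mul_comm]
          exact hmarkov
      _ = K * 2 ^ l * r ^ (-l) := by
          rw [Real.div_rpow hr0.le zero_le_two, Real.rpow_neg hr0.le]
          field_simp
      _ ≤ C * r ^ (-l) := by
          gcongr
          linarith

lemma exists_one_le_of_eventually_cobounded {E : Type*} [NormedAddCommGroup E] {P : E → Prop}
    (h : ∀ᶠ y in cobounded E, P y) : ∃ R : ℝ, 1 ≤ R ∧ ∀ y, R ≤ ‖y‖ → P y := by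
  obtain ⟨R, -, hR⟩ := hasBasis_cobounded_norm.eventually_iff.1 h
  exact ⟨max R 1, le_max_right _ _, fun y hy => hR ((le_max_left _ _).trans hy)⟩

theorem mainTheorem7 (d : ℕ) (W : EuclideanSpace ℝ (Fin d) → ℝ)
    (hWpos : ∀ y, 0 < W y) (hWdiff : Differentiable ℝ W)
    (hprob : IsProbabilityMeasure (negPowMeasure d W))
    (p β : ℝ) (hp : 1 < p) (hβ : 1 < β)
    (hgrowth : 0 < liminf (fun y => ((W y / ‖y‖ ^ p : ℝ) : EReal))
      (cobounded (EuclideanSpace ℝ (Fin d))))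
    (hgrad : (β : EReal) ≤ liminf (fun y => ((inner ℝ y (gradient W y) / W y : ℝ) : EReal))
      (cobounded (EuclideanSpace ℝ (Fin d))))
    (hmoment : (d : ℝ) * (max p β - 1) ≤ 1 → Integrable (fun y => ‖y‖) (negPowMeasure d W))
    (l : ℝ) (hl0 : 0 < l) (hl : l < d * (p - 1)) :
    ∃ r₀ > 0, ∃ C > 0, ∃ φ : ℝ → ℝ, (∀ r ≥ r₀, φ r = C * r ^ (-l)) ∧
      SatisfiesConcentration (negPowMeasure d W) φ r₀ := by
  obtain ⟨c, hc, R, hR, hWp⟩ : ∃ c > 0, ∃ R : ℝ, 1 ≤ R ∧ ∀ y, R ≤ ‖y‖ → c * ‖y‖ ^ p ≤ W y := by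
    obtain ⟨c, hc0, hc⟩ := EReal.lt_iff_exists_real_btwn.1 hgrowth
    obtain ⟨R, hR, h⟩ := exists_one_le_of_eventually_cobounded (eventually_lt_of_lt_liminf hc)
    refine ⟨c, by exact_mod_cast hc0, R, hR, fun y hy => ?_⟩
    have hy0 : 0 < ‖y‖ := by linarith
    exact (le_div_iff₀ (by positivity)).1 (EReal.coe_lt_coe_iff.1 (h y hy)).le
  refine exists_satisfiesConcentration_of_integrable hl0 ?_
    (integrable_rpow_norm_negPowMeasure hWpos hWdiff.continuous hc hR hWp hl0.le hl)
  by_cases hd : (d : ℝ) * (max p β - 1) ≤ 1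
  · exact hmoment hd
  suffices ∃ q c R : ℝ, 0 < c ∧ 1 ≤ R ∧ (∀ y, R ≤ ‖y‖ → c * ‖y‖ ^ q ≤ W y) ∧ 1 < d * (q - 1) by
    obtain ⟨q, c, R, hc, hR, h, hq⟩ := this
    simpa using integrable_rpow_norm_negPowMeasure hWpos hWdiff.continuous hc hR h zero_le_one hq
  rw [not_le] at hd
  rcases le_total β p with hβp | hpβ
  · rw [max_eq_left hβp] at hd
    exact ⟨p, c, R, hc, hR, hWp, hd⟩
  · rw [max_eq_right hpβ] at hd
    -- The lower limit only yields bounds with constants below `β`; the strict inequality `hd`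
    -- leaves room for such a `q`.
    obtain ⟨q, hqβ, hq⟩ : ∃ q < β, 1 < d * (q - 1) := by
      have hcont : Continuous fun q : ℝ => (d : ℝ) * (q - 1) := by fun_prop
      have := (hcont.tendsto β).eventually_const_lt hd
      exact ((eventually_mem_nhdsWithin (s := Iio β)).and
        (this.filter_mono nhdsWithin_le_nhds)).exists
    obtain ⟨R, hR, h⟩ := exists_one_le_of_eventually_cobounded
      (eventually_lt_of_lt_liminf ((EReal.coe_lt_coe_iff.2 hqβ).trans_le hgrad))
    obtain ⟨c, hc, h⟩ := exists_rpow_norm_le_of_le_inner_gradient hWpos hWdiff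
      (zero_lt_one.trans_le hR) (q := q) fun y hy =>
        (le_div_iff₀ (hWpos y)).1 (EReal.coe_lt_coe_iff.1 (h y hy)).le
    exact ⟨q, c, R, hc, hR, h, hq⟩
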